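/- Let $f:\mathbb{R}^n\times\mathbb{R}^m\to\mathbb{R}^n$ be continuous, and locally Lipschitz in $x$ uniformly for $u$ in compact sets. Write $|\cdot|$ for the Euclidean norm and $B_s=\{x:|x|\le s\}$. The proximal subdifferential $\partial_PV(x)$ is the set of $\zeta$ for which there is $\mu>0$ with $V(y)\ge V(x)+\zeta\cdot(y-x)-\mu|y-x|^2$ for all $y$ near $x$. Let $V$ be a control-Lyapunov function (clf) for $\dot x=f(x,u)$: $V:\mathbb{R}^n\to\mathbb{R}_{\ge0}$ is continuous, positive definite and proper, and there are a continuous positive definite $W:\mathbb{R}^n\to\mathbb{R}_{\ge 0}$ and a nondecreasing $\sigma:\mathbb{R}_{\ge0}\to\mathbb{R}_{\ge0}$ with $\min_{|u|\le\sigma(|x|)}\zeta\cdot f(x,u)\le -W(x)$ for all $x$ and all $\zeta\in\partial_PV(x)$. Put $$\gamma(s)=\min_{|x|\ge s}V(x),\qquad \rho(s)=\max\{\rho\ge0:\ V\le\tfrac12\gamma(s)\text{ on }B_\rho\},\qquad \beta(s)=\max_{B_s}V.$$ For $\alpha>0$ let $V_\alpha(x)=\inf_y\bigl[V(y)+\frac1{2\alpha^2}|y-x|^2\bigr]$.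 For a compact $U_0\subset\mathbb{R}^m$, a feedback $k_\alpha$ is any map obtained by choosing, for each $x$, a minimizer $y_\alpha(x)$ in the definition of $V_\alpha(x)$ and then letting $k_\alpha(x)$ be any minimizer over $u\in U_0$ of $\zeta_\alpha(x)\cdot f(x,u)$, where $\zeta_\alpha(x)=\alpha^{-2}(x-y_\alpha(x))$. A sampling schedule $\pi$ is a sequence $0=t_0<t_1<\cdots$ with $t_i\to\infty$; put $\underline d(\pi)=\inf_i(t_{i+1}-t_i)$ and $\overline d(\pi)=\sup_i(t_{i+1}-t_i)$. For $e:[0,\infty)\to\mathbb{R}^n$, a sampled trajectory of $\dot x=f(x,k(x+e))$ on $[0,\infty)$ satisfies $\dot x(t)=f\bigl(x(t),k(x(t_i)+e(t_i))\bigr)$ on each $[t_i,t_{i+1}]$. **Proposition (semiglobal practical stabilization on an annulus).** Let $0<r<R$ with $2\gamma(r)<\gamma(R)$, and let $U_0\subset\mathbb{R}^m$ be compact with $\min_{u\in U_0}\zeta\cdot f(x,u)\le-W(x)$ for all $x\in B_{R+\sqrt{2\beta(R)}}$ and all $\zeta\in\partial_PV(x)$. Then there are $\alpha,\delta,\kappa,T>0$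 such that a feedback $k_\alpha$ exists and, for every feedback $k=k_\alpha$, every sampling schedule $\pi$ with $\overline d(\pi)\le\delta$, and every $e$ with $|e(t)|\le\kappa\,\underline d(\pi)$ for all $t\ge0$, the following holds. Let $P$ be the set of all $x$ such that $V_\alpha\le\frac12\gamma(R)$ on the closed ball of radius $\kappa\,\underline d(\pi)$ about $x$. Then $B_{\rho(R)/2}\subset P$. For each $x_0\in P$ (in particular, whenever $|x_0|\le\frac12\rho(R)$) there is a sampled trajectory of $\dot x=f(x,k(x+e))$ on $[0,\infty)$ with $x(0)=x_0$, and every such trajectory satisfies $$x(t)\in B_R\ \text{ for all } t\ge0,\qquad x(t)\in B_r\ \text{ for all } t\ge T.$$ -/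

import Mathlib

open Set Filter Topology

namespace SampledFeedback

noncomputable section

/-- Standing regularity of the right-hand side `f(x,u)`: jointly continuous, and locally Lipschitz
in the state `x`, uniformly for `u` in compact sets. (Every jointly locally Lipschitz map has this
property.) -/
def IsRegularDynamics {E U : Type*} [NormedAddCommGroup E] [NormedAddCommGroup U]
    (f : E → U → E) : Prop :=
  Continuous (Function.uncurry f) ∧
    ∀ C : Set U, IsCompact C → ∀ x₀ : E, ∃ L : NNReal, ∃ N ∈ 𝓝 x₀,
      ∀ u ∈ C, LipschitzOnWith L (fun x => f x u) N

/-- Positive definite functions `V : E → ℝ≥0`: `V(0) = 0` and `V(x) > 0` for `x ≠ 0`. -/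
def IsPosDefFun {E : Type*} [NormedAddCommGroup E] (V : E → ℝ) : Prop :=
  V 0 = 0 ∧ ∀ x, x ≠ 0 → 0 < V x

/-- The proximal subdifferential `∂_P V(x)`: all `ζ` such that, for some `μ > 0` and all `y` near
`x`, `V(y) ≥ V(x) + ζ·(y - x) - μ |y - x|²`. -/
def proximalSubdiff {E : Type*} [NormedAddCommGroup E] [InnerProductSpace ℝ E]
    (V : E → ℝ) (x : E) : Set E :=
  {ζ | ∃ μ : ℝ, 0 < μ ∧ ∀ᶠ y in 𝓝 x, V x + inner ℝ ζ (y - x) - μ * ‖y - x‖ ^ 2 ≤ V y}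

/-- `V` is a continuous control-Lyapunov function for `ẋ = f(x,u)`, with decrease rate `W` and
control bound `σ`: `V` is continuous, positive definite and proper, `W` is continuous and positive
definite, `σ : ℝ≥0 → ℝ≥0` is nondecreasing, and
`min_{|u| ≤ σ(|x|)} ζ·f(x,u) + W(x) ≤ 0` for all `x` and all `ζ ∈ ∂_P V(x)`. -/
structure IsCLF {E U : Type*} [NormedAddCommGroup E] [InnerProductSpace ℝ E]
    [NormedAddCommGroup U] (f : E → U → E) (V W : E → ℝ) (σ : ℝ → ℝ) : Prop where
  continuous : Continuous V
  posDef : IsPosDefFun V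
  proper : Tendsto V (cocompact E) atTop
  continuous_rate : Continuous W
  posDef_rate : IsPosDefFun W
  bound_nonneg : ∀ s, 0 ≤ s → 0 ≤ σ s
  bound_mono : MonotoneOn σ (Ici 0)
  decrease : ∀ x, ∀ ζ ∈ proximalSubdiff V x,
    ∃ u : U, ‖u‖ ≤ σ ‖x‖ ∧ inner ℝ ζ (f x u) + W x ≤ 0

/-- `γ(r) = min {V(x) : |x| ≥ r}`. -/
def gam {E : Type*} [NormedAddCommGroup E] (V : E → ℝ) (r : ℝ) : ℝ :=
  sInf (V '' {x | r ≤ ‖x‖})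

/-- `ρ(r)` is the largest radius of a closed ball about `0` contained in `{V ≤ γ(r)/2}`. -/
def rad {E : Type*} [NormedAddCommGroup E] (V : E → ℝ) (r : ℝ) : ℝ :=
  sSup {s : ℝ | 0 ≤ s ∧ ∀ x, ‖x‖ ≤ s → V x ≤ gam V r / 2}

/-- `β(R) = max {V(x) : |x| ≤ R}`. -/
def bet {E : Type*} [NormedAddCommGroup E] (V : E → ℝ) (R : ℝ) : ℝ :=
  sSup (V '' {x | ‖x‖ ≤ R})

/-- The function minimized in the inf-convolution: `y ↦ V(y) + |y - x|² / (2 α²)`. -/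
def penalized {E : Type*} [NormedAddCommGroup E] (V : E → ℝ) (α : ℝ) (x y : E) : ℝ :=
  V y + 1 / (2 * α ^ 2) * ‖y - x‖ ^ 2

/-- The inf-convolution `V_α(x) = inf_y [V(y) + |y - x|² / (2 α²)]`. -/
def infConv {E : Type*} [NormedAddCommGroup E] (V : E → ℝ) (α : ℝ) (x : E) : ℝ :=
  ⨅ y, penalized V α x y

/-- `k` is a feedback `k_α`: for every `x` there is selected a minimizer `y_α(x)` in the definition
of `V_α(x)`, and `k(x)` is any minimizer of `u ↦ ζ_α(x)·f(x,u)` over `U₀`, where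
`ζ_α(x) = (x - y_α(x)) / α²`. -/
def IsInfConvFeedback {E U : Type*} [NormedAddCommGroup E] [InnerProductSpace ℝ E]
    (f : E → U → E) (V : E → ℝ) (U₀ : Set U) (α : ℝ) (k : E → U) : Prop :=
  ∃ y : E → E, (∀ x, IsMinOn (penalized V α x) univ (y x)) ∧
    ∀ x, k x ∈ U₀ ∧
      IsMinOn (fun u => inner ℝ ((1 / α ^ 2) • (x - y x)) (f x u)) U₀ (k x)

/-- A sampling schedule `0 = t₀ < t₁ < t₂ < ⋯` with `tᵢ → ∞`. -/
structure SamplingSchedule where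
  time : ℕ → ℝ
  time_zero : time 0 = 0
  time_strictMono : StrictMono time
  time_tendsto : Tendsto time atTop atTop

/-- The lower diameter `inf_i (t_{i+1} - t_i)` of a sampling schedule. -/
def SamplingSchedule.lowerDiam (π : SamplingSchedule) : ℝ :=
  ⨅ i, (π.time (i + 1) - π.time i)

/-- `x` solves `ẋ = f(x, k(x + e))` on `[0,∞)` in the sampled sense: on every `[tᵢ, tᵢ₊₁]`,
`ẋ(t) = f(x(t), k(x(tᵢ) + e(tᵢ)))`. (Values of `x` at negative times are irrelevant.) -/
def IsSampledSolution {E U : Type*} [NormedAddCommGroup E] [NormedSpace ℝ E]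
    (f : E → U → E) (k : E → U) (e : ℝ → E) (π : SamplingSchedule) (x : ℝ → E) : Prop :=
  ∀ i, ∀ t ∈ Icc (π.time i) (π.time (i + 1)),
    HasDerivWithinAt x (f (x t) (k (x (π.time i) + e (π.time i))))
      (Icc (π.time i) (π.time (i + 1))) t

/-- The sublevel set `{V_α ≤ γ(R)/2}` shrunk by the measurement accuracy `ε`: all `x` whose closed
`ε`-ball lies in that sublevel set. -/
def initialSet {E : Type*} [NormedAddCommGroup E] (V : E → ℝ) (α R ε : ℝ) : Set E :=
  {x | ∀ z, ‖z - x‖ ≤ ε → infConv V α z ≤ gam V R / 2}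

end

end SampledFeedback

/-!
The inf-convolution `V_α` of a control-Lyapunov function `V` repairs the lack of smoothness of `V`:
it is semiconcave, so that `ζ_α(x) = (x - y_α(x)) / α²` satisfies
`V_α(z) ≤ V_α(x) + ζ_α(x)·(z - x) + |z - x|² / (2α²)` for *all* `z` (`infConv_le_add_inner`). At the
same time `ζ_α(x)` is a proximal subgradient of `V` at the minimizer `y_α(x)`
(`mem_proximalSubdiff_of_isMinOn`), where the Lyapunov inequality provides a control. As
`|x - y_α(x)|² / α²` tends to `0` uniformly on `B_R` when `α → 0`, this control is still good at `x`:
for small `α` the feedback satisfies `ζ_α(x)·f(x, k(x)) ≤ -c` for some `c > 0` at all `x ∈ B_R` with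
`V_α(x) ≥ γ(r)/8` (`eventually_inner_le_neg`). Uniform closeness of `V_α` to `V` also puts the
sublevel sets `{V_α ≤ 3γ(R)/4}` and `{V_α ≤ 3γ(r)/4}` into `B_R` and `B_r`
(`eventually_norm_le_of_infConv_le`).

What remains concerns a semiconcave function `φ = V_α` decreasing in this infinitesimal sense
(`IsDecreasing`). On one sampling interval of length `τ ≤ δ`, the supergradient inequality at the
measured state gives a change of `φ` by at most `-c τ` plus an error of order `|e| + τ (|e| + τ)`;
with `|e| ≤ κ τ` and small `δ`, `κ` the total is at most `-c τ / 2`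
(`IsDecreasing.le_sub_of_step`). This is where the measurement error has to be small relative to the
lower diameter of the schedule. With `a = γ(r)/8`, the estimate applies while `φ ≥ 2a`, and otherwise
`φ` grows by at most `a` in one interval. Hence `φ(x(tᵢ)) ≤ max (3a) (γ(R)/2 - c tᵢ / 2)`, and `φ`
exceeds this value by at most `a` between sampling times, which gives both the invariance of `B_R`
and the attraction to `B_r`. The same bound at the sampling times keeps the states in the range where
the Picard-Lindelöf theorem yields solutions on whole sampling intervals, so these can be
concatenated.
-/

namespace SampledFeedback

/-! ### Uniform bounds for the dynamics -/

section Dynamics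

variable {E U : Type*} [NormedAddCommGroup E] [NormedAddCommGroup U] {f : E → U → E}

/-- The local Lipschitz condition on `f` says that `x ↦ f x ·`, as a map into the space `C(U₀, E)`
with the supremum distance, is locally Lipschitz; hence it is Lipschitz on compact sets. -/
lemma IsRegularDynamics.exists_lipschitzOnWith (hf : IsRegularDynamics f) {U₀ : Set U}
    (hU₀ : IsCompact U₀) {K : Set E} (hK : IsCompact K) :
    ∃ L : NNReal, ∀ u ∈ U₀, LipschitzOnWith L (fun x => f x u) K := by
  have : CompactSpace U₀ := isCompact_iff_compactSpace.mp hU₀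
  let F : E → C(U₀, E) := fun x =>
    ⟨fun u => f x u, hf.1.comp (continuous_const.prodMk continuous_subtype_val)⟩
  have hF : LocallyLipschitzOn K F := by
    intro x _
    obtain ⟨L, N, hN, hL⟩ := hf.2 U₀ hU₀ x
    refine ⟨L, N, mem_nhdsWithin_of_mem_nhds hN, LipschitzOnWith.of_dist_le_mul ?_⟩
    intro a ha b hb
    rw [ContinuousMap.dist_le (by positivity)]
    exact fun u => (hL u u.2).dist_le_mul a ha b hb
  obtain ⟨L, hL⟩ := hF.exists_lipschitzOnWith_of_compact hK
  refine ⟨L, fun u hu => LipschitzOnWith.of_dist_le_mul fun a ha b hb => ?_⟩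
  exact (ContinuousMap.dist_apply_le_dist (f := F a) (g := F b) ⟨u, hu⟩).trans
    (hL.dist_le_mul a ha b hb)

lemma IsRegularDynamics.exists_norm_lt (hf : IsRegularDynamics f) {U₀ : Set U}
    (hU₀ : IsCompact U₀) {K : Set E} (hK : IsCompact K) :
    ∃ M : ℝ, 0 < M ∧ ∀ u ∈ U₀, ∀ x ∈ K, ‖f x u‖ < M := by
  obtain ⟨C, hC⟩ := (hK.prod hU₀).exists_bound_of_continuousOn hf.1.continuousOn
  refine ⟨max C 0 + 1, by positivity, fun u hu x hx => ?_⟩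
  have := hC (x, u) ⟨hx, hu⟩
  simp only [Function.uncurry] at this
  linarith [le_max_left C 0]

end Dynamics

/-! ### The quantities attached to the Lyapunov function -/

section Lyapunov

variable {E : Type*} [NormedAddCommGroup E] {V : E → ℝ}

lemma IsPosDefFun.nonneg (hV : IsPosDefFun V) (x : E) : 0 ≤ V x := by
  by_cases hx : x = 0
  · simp [hx, hV.1]
  · exact (hV.2 x hx).le

lemma gam_le (hV : IsPosDefFun V) {s : ℝ} {x : E} (hx : s ≤ ‖x‖) : gam V s ≤ V x :=
  csInf_le ⟨0, by rintro _ ⟨y, -, rfl⟩; exact hV.nonneg y⟩ ⟨x, hx, rfl⟩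

lemma norm_lt_of_lt_gam (hV : IsPosDefFun V) {s : ℝ} {x : E} (hx : V x < gam V s) : ‖x‖ < s :=
  lt_of_not_ge fun h => hx.not_ge (gam_le hV h)

lemma le_bet [ProperSpace E] (hc : Continuous V) {s : ℝ} {x : E} (hx : ‖x‖ ≤ s) :
    V x ≤ bet V s := by
  have h : IsCompact {x : E | ‖x‖ ≤ s} := by
    simpa [Metric.closedBall, dist_zero_right] using isCompact_closedBall (0 : E) s
  exact le_csSup (h.image hc).bddAbove ⟨x, hx, rfl⟩

lemma gam_pos [Nontrivial E] [NormedSpace ℝ E] [ProperSpace E] (hV : IsPosDefFun V)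
    (hc : Continuous V) (hp : Tendsto V (cocompact E) atTop) {s : ℝ} (hs : 0 < s) :
    0 < gam V s := by
  have hcl : IsClosed {x : E | s ≤ ‖x‖} := isClosed_le continuous_const continuous_norm
  obtain ⟨x₀, hx₀⟩ := exists_norm_eq E hs.le
  obtain ⟨x, hx, hmin⟩ := hc.continuousOn.exists_isMinOn' hcl (x₀ := x₀) hx₀.ge
    ((hp.eventually_ge_atTop (V x₀)).filter_mono inf_le_left)
  have hx0 : x ≠ 0 := norm_pos_iff.mp (hs.trans_le hx)
  refine (hV.2 x hx0).trans_le (le_csInf ⟨_, x, hx, rfl⟩ ?_)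
  rintro _ ⟨y, hy, rfl⟩
  exact hmin hy

/-- `V ≤ γ(s)/2` on the open ball of radius `ρ(s)`; nothing is needed on the boundary. -/
lemma le_of_norm_lt_rad {s : ℝ} {x : E} (h0 : V 0 = 0) (hs : 0 ≤ gam V s)
    (hx : ‖x‖ < rad V s) : V x ≤ gam V s / 2 := by
  obtain ⟨q, hq, hxq⟩ := exists_lt_of_lt_csSup
    (s := {q : ℝ | 0 ≤ q ∧ ∀ x, ‖x‖ ≤ q → V x ≤ gam V s / 2})
    ⟨0, le_rfl, fun y hy => by rw [norm_le_zero_iff.mp hy, h0]; positivity⟩ hx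
  exact hq.2 x hxq.le

lemma rad_pos [Nontrivial E] [NormedSpace ℝ E] (hV : IsPosDefFun V)
    (hc : Continuous V) {s : ℝ} (hs : 0 < s) (hg : 0 < gam V s) : 0 < rad V s := by
  have hnear : ∀ᶠ x in 𝓝 (0 : E), V x < gam V s / 2 :=
    hc.continuousAt.eventually_lt continuousAt_const (by rw [hV.1]; positivity)
  obtain ⟨q, hq, hball⟩ := Metric.eventually_nhds_iff.mp hnear
  have hmem : q / 2 ∈ {q : ℝ | 0 ≤ q ∧ ∀ x : E, ‖x‖ ≤ q → V x ≤ gam V s / 2} :=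
    ⟨by positivity, fun x hx => (hball (by rw [dist_zero_right]; linarith)).le⟩
  refine (half_pos hq).trans_le (le_csSup ⟨s, ?_⟩ hmem)
  rintro p ⟨hp, hV'⟩
  by_contra! hlt
  obtain ⟨x, hx⟩ := exists_norm_eq E hs.le
  linarith [hV' x (by linarith), gam_le hV hx.ge]

lemma exists_modulus [ProperSpace E] {g : E → ℝ} (hc : Continuous g) (q : ℝ) {η : ℝ} (hη : 0 < η) :
    ∃ d > 0, ∀ x y : E, ‖x‖ ≤ q → ‖y‖ ≤ q → ‖x - y‖ < d → g x < g y + η := by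
  have hu := (isCompact_closedBall (0 : E) q).uniformContinuousOn_of_continuous hc.continuousOn
  obtain ⟨d, hd, h⟩ := Metric.uniformContinuousOn_iff.mp hu η hη
  refine ⟨d, hd, fun x y hx hy hxy => ?_⟩
  have := h x (by simpa using hx) y (by simpa using hy) (by rwa [dist_eq_norm])
  rw [Real.dist_eq, abs_lt] at this
  linarith

end Lyapunov

/-! ### The inf-convolution -/

section InfConv

variable {E : Type*} [NormedAddCommGroup E] {V : E → ℝ} {α : ℝ} {x y : E}

lemma exists_isMinOn_penalized [ProperSpace E] (hc : Continuous V)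
    (hp : Tendsto V (cocompact E) atTop) (α : ℝ) (x : E) :
    ∃ y, IsMinOn (penalized V α x) univ y := by
  have hcont : Continuous (penalized V α x) := by unfold penalized; fun_prop
  obtain ⟨y, hy⟩ := hcont.exists_forall_le
    (tendsto_atTop_mono (fun y => le_add_of_nonneg_right (by positivity)) hp)
  exact ⟨y, fun w _ => hy w⟩

lemma infConv_eq_of_isMinOn (h : IsMinOn (penalized V α x) univ y) :
    infConv V α x = penalized V α x y :=
  le_antisymm (ciInf_le ⟨_, by rintro _ ⟨w, rfl⟩; exact h (mem_univ w)⟩ y)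
    (le_ciInf fun w => h (mem_univ w))

lemma infConv_le_penalized (hV : IsPosDefFun V) (α : ℝ) (x y : E) :
    infConv V α x ≤ penalized V α x y :=
  ciInf_le ⟨0, by
    rintro _ ⟨w, rfl⟩; exact add_nonneg (hV.nonneg w) (by positivity)⟩ y

lemma infConv_le (hV : IsPosDefFun V) (α : ℝ) (x : E) : infConv V α x ≤ V x := by
  simpa [penalized] using infConv_le_penalized hV α x x

lemma le_infConv_of_isMinOn (h : IsMinOn (penalized V α x) univ y) : V y ≤ infConv V α x := by
  rw [infConv_eq_of_isMinOn h]
  exact le_add_of_nonneg_right (by positivity)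

lemma sq_norm_sub_eq_of_isMinOn (hα : 0 < α) (h : IsMinOn (penalized V α x) univ y) :
    ‖y - x‖ ^ 2 = 2 * α ^ 2 * (infConv V α x - V y) := by
  rw [infConv_eq_of_isMinOn h, penalized]
  field_simp
  ring

/-- A minimizer in the definition of `V_α(x)` is at distance `O(α)` from `x`. -/
lemma norm_sub_le_of_isMinOn (hV : IsPosDefFun V) (hα : 0 < α)
    (h : IsMinOn (penalized V α x) univ y) {b : ℝ} (hb : infConv V α x ≤ b) :
    ‖y - x‖ ≤ α * Real.sqrt (2 * b) := by
  rw [← Real.sqrt_sq hα.le, ← Real.sqrt_mul (by positivity)]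
  refine Real.le_sqrt_of_sq_le ?_
  rw [sq_norm_sub_eq_of_isMinOn hα h]
  nlinarith [hV.nonneg y, sq_nonneg α]

/-- Since `V_α` is close to `V` on bounded sets, its sublevel set at a level below `γ(s)` lies
in the ball `B_s` for small `α`. -/
lemma eventually_norm_le_of_infConv_le [ProperSpace E] (hV : IsPosDefFun V) (hc : Continuous V)
    (hp : Tendsto V (cocompact E) atTop) {s : ℝ} (hg : 0 < gam V s) :
    ∀ᶠ α in 𝓝[>] (0 : ℝ), ∀ x : E, infConv V α x ≤ 3 / 4 * gam V s → ‖x‖ ≤ s := by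
  obtain ⟨d, hd, hmod⟩ := exists_modulus hc (s + 1) (show 0 < gam V s / 8 by positivity)
  have hlim : Tendsto (fun α : ℝ => α * Real.sqrt (2 * (3 / 4 * gam V s))) (𝓝[>] 0) (𝓝 0) :=
    ((continuous_id.mul continuous_const).tendsto' 0 0 (by simp)).mono_left nhdsWithin_le_nhds
  filter_upwards [self_mem_nhdsWithin, hlim.eventually_lt_const (lt_min hd one_pos)]
    with α hα hsmall x hx
  obtain ⟨y, hy⟩ := exists_isMinOn_penalized hc hp α x
  have hdist := (norm_sub_le_of_isMinOn hV hα hy hx).trans_lt hsmall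
  have hy1 := le_infConv_of_isMinOn hy
  have hys : ‖y‖ < s := norm_lt_of_lt_gam hV (by linarith)
  have hxs : ‖x‖ ≤ s + 1 := by
    have := norm_sub_norm_le x y
    rw [norm_sub_rev] at this
    linarith [min_le_right d 1]
  have := hmod x y hxs (by linarith)
    (by rw [norm_sub_rev]; exact hdist.trans_le (min_le_left _ _))
  exact (norm_lt_of_lt_gam hV (by linarith)).le

/-- The ball of half the radius `ρ(R)` consists of admissible initial states. -/
lemma closedBall_subset_initialSet (hV : IsPosDefFun V) {R ε : ℝ} (hg : 0 ≤ gam V R)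
    (hρ : 0 < rad V R) (hε : ε ≤ rad V R / 4) :
    Metric.closedBall 0 (rad V R / 2) ⊆ initialSet V α R ε := by
  intro x hx z hz
  rw [mem_closedBall_zero_iff] at hx
  refine (infConv_le hV α z).trans (le_of_norm_lt_rad hV.1 hg ?_)
  linarith [norm_sub_norm_le z x]

variable [InnerProductSpace ℝ E]

lemma mem_proximalSubdiff_of_isMinOn (hα : 0 < α) (h : IsMinOn (penalized V α x) univ y) :
    (1 / α ^ 2) • (x - y) ∈ proximalSubdiff V y := by
  refine ⟨1 / (2 * α ^ 2), by positivity, Eventually.of_forall fun w => ?_⟩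
  have hw : penalized V α x y ≤ penalized V α x w := h (mem_univ w)
  have hn : ‖w - x‖ ^ 2 = ‖w - y‖ ^ 2 - 2 * inner ℝ (x - y) (w - y) + ‖y - x‖ ^ 2 := by
    rw [show w - x = (w - y) - (x - y) by abel, norm_sub_sq_real, norm_sub_rev x y,
      real_inner_comm]
  rw [penalized, penalized, hn] at hw
  rw [real_inner_smul_left]
  field_simp at hw ⊢
  linarith

/-- `ζ_α(x)` is a proximal supergradient of `V_α` at `x`, with a uniform quadratic constant: `V_α`
is semiconcave. -/
lemma infConv_le_add_inner (hV : IsPosDefFun V) (hα : 0 < α)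
    (h : IsMinOn (penalized V α x) univ y) (z : E) :
    infConv V α z ≤ infConv V α x + inner ℝ ((1 / α ^ 2) • (x - y)) (z - x)
      + 1 / (2 * α ^ 2) * ‖z - x‖ ^ 2 := by
  refine (infConv_le_penalized hV α z y).trans_eq ?_
  have hn : ‖y - z‖ ^ 2 = ‖y - x‖ ^ 2 + 2 * inner ℝ (x - y) (z - x) + ‖z - x‖ ^ 2 := by
    rw [show y - z = (y - x) - (z - x) by abel, norm_sub_sq_real, ← neg_sub x y, inner_neg_left]
    ring
  rw [infConv_eq_of_isMinOn h, penalized, penalized, hn, real_inner_smul_left]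
  field_simp
  ring

lemma norm_smul_sub_le_of_isMinOn (hV : IsPosDefFun V) (hα : 0 < α)
    (h : IsMinOn (penalized V α x) univ y) {b : ℝ} (hb : infConv V α x ≤ b) :
    ‖(1 / α ^ 2) • (x - y)‖ ≤ Real.sqrt (2 * b) / α := by
  rw [norm_smul, Real.norm_of_nonneg (by positivity), norm_sub_rev]
  have := norm_sub_le_of_isMinOn hV hα h hb
  calc 1 / α ^ 2 * ‖y - x‖ ≤ 1 / α ^ 2 * (α * Real.sqrt (2 * b)) := by gcongr
    _ = Real.sqrt (2 * b) / α := by field_simp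

end InfConv

/-! ### Decrease along the feedback -/

section Decrease

variable {E U : Type*} [NormedAddCommGroup E] [InnerProductSpace ℝ E] [ProperSpace E]
  [NormedAddCommGroup U] {f : E → U → E} {V W : E → ℝ}

/-- The direction `ζ_α(x)` is a proximal subgradient of `V` at the minimizer `y = y_α(x)`, where
some control makes `ζ_α(x)·f(y,u) ≤ -W(y)`. Moving from `y` to `x` costs at most
`|ζ_α(x)| L |x - y| = L |x - y|² / α² ≤ 2 L (V(x) - V(y))`, which is small with `α`. -/
lemma eventually_inner_le_neg (hf : IsRegularDynamics f) (hV : IsPosDefFun V)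
    (hVc : Continuous V) (hW : IsPosDefFun W) (hWc : Continuous W)
    {U₀ : Set U} (hU₀ : IsCompact U₀) {R : ℝ}
    (hdec : ∀ x, ‖x‖ ≤ R + Real.sqrt (2 * bet V R) → ∀ ζ ∈ proximalSubdiff V x,
      ∃ u ∈ U₀, inner ℝ ζ (f x u) ≤ -W x) {a : ℝ} (ha : 0 < a) :
    ∃ c > 0, ∀ᶠ α in 𝓝[>] (0 : ℝ), ∀ x y : E, ∀ u : U, ‖x‖ ≤ R → a ≤ infConv V α x →
      IsMinOn (penalized V α x) univ y →
      IsMinOn (fun u => inner ℝ ((1 / α ^ 2) • (x - y)) (f x u)) U₀ u →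
      inner ℝ ((1 / α ^ 2) • (x - y)) (f x u) ≤ -c := by
  set S := Real.sqrt (2 * bet V R) with hS
  have hS0 : 0 ≤ S := Real.sqrt_nonneg _
  obtain ⟨L, hL⟩ := hf.exists_lipschitzOnWith hU₀ (isCompact_closedBall (0 : E) (R + S))
  have hK : IsCompact (Metric.closedBall (0 : E) (R + S) ∩ {y | a / 2 ≤ V y}) :=
    (isCompact_closedBall _ _).inter_right (isClosed_le continuous_const hVc)
  obtain ⟨w, hw, hwK⟩ := hK.exists_forall_le' hWc.continuousOn (a := 0) (by
    rintro y ⟨-, hy⟩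
    refine hW.2 y ?_
    rintro rfl
    rw [mem_ofPred_eq, hV.1] at hy
    linarith)
  have hη : 0 < min (a / 2) (w / (4 * (L + 1))) := by positivity
  obtain ⟨d, hd, hmod⟩ := exists_modulus hVc (R + S) hη
  have hlim : Tendsto (fun α : ℝ => α * S) (𝓝[>] 0) (𝓝 0) :=
    ((continuous_id.mul continuous_const).tendsto' 0 0 (by simp)).mono_left nhdsWithin_le_nhds
  refine ⟨w / 2, by positivity, ?_⟩
  filter_upwards [self_mem_nhdsWithin, hlim.eventually_lt_const hd,
    (tendsto_id.mono_left nhdsWithin_le_nhds : Tendsto id (𝓝[>] (0 : ℝ)) (𝓝 0)).eventually_lt_const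
      one_pos] with α (hα : 0 < α) hαd hα1 x y u hx hax hy hu
  have hα1 : α < 1 := hα1
  have hdist : ‖y - x‖ ≤ α * S :=
    norm_sub_le_of_isMinOn hV hα hy ((infConv_le hV α x).trans (le_bet hVc hx))
  have hyQ : ‖y‖ ≤ R + S := by
    have := norm_sub_norm_le y x
    nlinarith
  have hxQ : ‖x‖ ≤ R + S := by linarith
  have hVxy := hmod x y hxQ hyQ (by rw [norm_sub_rev]; linarith)
  have hVx := infConv_le hV α x
  have hη1 := min_le_left (a / 2) (w / (4 * (L + 1)))
  have hη2 := min_le_right (a / 2) (w / (4 * (L + 1)))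
  have hWy : w ≤ W y := hwK y ⟨by simpa using hyQ, by rw [mem_ofPred_eq]; linarith⟩
  obtain ⟨v, hv, hvW⟩ := hdec y hyQ _ (mem_proximalSubdiff_of_isMinOn hα hy)
  set ζ := (1 / α ^ 2) • (x - y) with hζ
  have hmin : inner ℝ ζ (f x u) ≤ inner ℝ ζ (f x v) := hu hv
  have hlip : ‖f x v - f y v‖ ≤ L * ‖x - y‖ := by
    simpa [dist_eq_norm] using
      (hL v hv).dist_le_mul x (by simpa using hxQ) y (by simpa using hyQ)
  have hcost : inner ℝ ζ (f x v - f y v) ≤ w / 2 := by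
    calc inner ℝ ζ (f x v - f y v) ≤ ‖ζ‖ * ‖f x v - f y v‖ := real_inner_le_norm _ _
      _ ≤ (1 / α ^ 2 * ‖x - y‖) * (L * ‖x - y‖) := by
          rw [hζ, norm_smul, Real.norm_of_nonneg (by positivity)]; gcongr
      _ = L * (‖y - x‖ ^ 2 / α ^ 2) := by rw [norm_sub_rev y x]; ring
      _ = L * (2 * (infConv V α x - V y)) := by
          rw [sq_norm_sub_eq_of_isMinOn hα hy]; field_simp
      _ ≤ L * (2 * (w / (4 * (L + 1)))) := by gcongr; linarith
      _ ≤ (L + 1) * (2 * (w / (4 * (L + 1)))) := by gcongr; linarith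
      _ = w / 2 := by field_simp; ring
  rw [inner_sub_right] at hcost
  linarith

end Decrease

/-! ### Sampling schedules -/

namespace SamplingSchedule

variable (π : SamplingSchedule)

lemma lowerDiam_nonneg : 0 ≤ π.lowerDiam :=
  le_ciInf fun i => sub_nonneg.mpr (π.time_strictMono i.lt_succ_self).le

lemma lowerDiam_le (i : ℕ) : π.lowerDiam ≤ π.time (i + 1) - π.time i :=
  ciInf_le ⟨0, by
    rintro _ ⟨j, rfl⟩; exact sub_nonneg.mpr (π.time_strictMono j.lt_succ_self).le⟩ i

lemma time_nonneg (i : ℕ) : 0 ≤ π.time i :=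
  π.time_zero ▸ π.time_strictMono.monotone i.zero_le

lemma exists_mem_Ico {t : ℝ} (ht : 0 ≤ t) : ∃ i, t ∈ Ico (π.time i) (π.time (i + 1)) := by
  obtain ⟨j, hj⟩ := (π.time_tendsto.eventually_gt_atTop t).exists
  induction j with
  | zero => exact absurd ht (by rw [π.time_zero] at hj; exact hj.not_ge)
  | succ j ih =>
    rcases lt_or_ge t (π.time j) with h | h
    · exact ih h
    · exact ⟨j, h, hj⟩

lemma eq_of_mem_Ico {t : ℝ} {i j : ℕ} (hi : t ∈ Ico (π.time i) (π.time (i + 1)))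
    (hj : t ∈ Ico (π.time j) (π.time (j + 1))) : i = j := by
  have h1 := π.time_strictMono.lt_iff_lt.mp (hi.1.trans_lt hj.2)
  have h2 := π.time_strictMono.lt_iff_lt.mp (hj.1.trans_lt hi.2)
  omega

end SamplingSchedule

/-- Solutions on the individual sampling intervals, each keeping the invariant `P` at the next
sampling time, concatenate to a sampled solution on `[0,∞)`. -/
lemma exists_isSampledSolution {E U : Type*} [NormedAddCommGroup E] [NormedSpace ℝ E]
    {f : E → U → E} {k : E → U} {e : ℝ → E} {π : SamplingSchedule} {P : E → Prop}
    (hstep : ∀ i x, P x → ∃ s : ℝ → E, s (π.time i) = x ∧ P (s (π.time (i + 1))) ∧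
      ∀ t ∈ Icc (π.time i) (π.time (i + 1)),
        HasDerivWithinAt s (f (s t) (k (x + e (π.time i)))) (Icc (π.time i) (π.time (i + 1))) t)
    {x₀ : E} (hx₀ : P x₀) : ∃ x : ℝ → E, IsSampledSolution f k e π x ∧ x 0 = x₀ := by
  choose! s hs hP hderiv using hstep
  let X : ℕ → E := fun i => Nat.rec x₀ (fun j y => s j y (π.time (j + 1))) i
  have hX : ∀ i, P (X i) := fun i => by
    induction i with
    | zero => exact hx₀
    | succ j ih => exact hP j _ ih
  have hidx : ∀ t : ℝ, ∃ i, 0 ≤ t → t ∈ Ico (π.time i) (π.time (i + 1)) := fun t => by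
    by_cases ht : 0 ≤ t
    · exact (π.exists_mem_Ico ht).imp fun _ h _ => h
    · exact ⟨0, fun h => absurd h ht⟩
  choose idx hidx using hidx
  have heq : ∀ i, ∀ t ∈ Ico (π.time i) (π.time (i + 1)), s (idx t) (X (idx t)) t = s i (X i) t :=
    fun i t ht => by
      rw [π.eq_of_mem_Ico (hidx t ((π.time_nonneg i).trans ht.1)) ht]
  have hnode : ∀ i, s (idx (π.time i)) (X (idx (π.time i))) (π.time i) = X i := fun i => by
    rw [heq i _ ⟨le_rfl, π.time_strictMono i.lt_succ_self⟩, hs i _ (hX i)]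
  have heq' : ∀ i, ∀ t ∈ Icc (π.time i) (π.time (i + 1)),
      s (idx t) (X (idx t)) t = s i (X i) t := fun i t ht => by
    rcases ht.2.lt_or_eq with h | rfl
    · exact heq i t ⟨ht.1, h⟩
    · exact hnode (i + 1)
  refine ⟨fun t => s (idx t) (X (idx t)) t, fun i t ht => ?_, ?_⟩
  · simp only [hnode i, heq' i t ht]
    exact (hderiv i _ (hX i) t ht).congr (heq' i) (heq' i t ht)
  · have h0 := hnode 0
    rwa [π.time_zero] at h0

/-! ### One sampling interval -/

section Step

variable {E : Type*} [NormedAddCommGroup E] [NormedSpace ℝ E] {g : E → E} {x : ℝ → E}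
  {p q R M : ℝ}

lemma norm_sub_le_of_hasDerivWithinAt (hx : ∀ t ∈ Icc p q, HasDerivWithinAt x (g (x t)) (Icc p q) t)
    (hp : ‖x p‖ ≤ R) (hg : ∀ z, ‖z‖ ≤ R + 1 → ‖g z‖ < M) (hM : 0 ≤ M) (hpq : M * (q - p) ≤ 1) :
    ∀ t ∈ Icc p q, ‖x t - x p‖ ≤ M * (t - p) := by
  refine image_norm_le_of_norm_deriv_right_lt_deriv_boundary (f' := fun t => g (x t))
    (f := fun t => x t - x p) (B := fun t => M * (t - p)) (B' := fun _ => M)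
    (fun t ht => ((hx t ht).sub_const _).continuousWithinAt)
    (fun t ht => ((hx t (Ico_subset_Icc_self ht)).sub_const _).mono_of_mem_nhdsWithin
      (Icc_mem_nhdsGE_of_mem ht)) (by simp)
    (fun t => by simpa using ((hasDerivAt_id t).sub_const p).const_mul M) ?_
  -- At a first contact with the barrier the solution is still in the ball where `‖g‖ < M`.
  intro t ht hbd
  refine hg _ ?_
  have h1 := norm_sub_norm_le (x t) (x p)
  have h2 : M * (t - p) ≤ M * (q - p) := by gcongr; exact ht.2.le
  linarith

lemma exists_solution_Icc [CompleteSpace E] {L : NNReal} (hpq : p ≤ q) {x₀ : E} (hx₀ : ‖x₀‖ ≤ R)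
    (hlip : LipschitzOnWith L g (Metric.closedBall 0 (R + 1)))
    (hg : ∀ z, ‖z‖ ≤ R + 1 → ‖g z‖ < M) (hM : 0 ≤ M) (hMpq : M * (q - p) ≤ 1) :
    ∃ s : ℝ → E, s p = x₀ ∧ ∀ t ∈ Icc p q, HasDerivWithinAt s (g (s t)) (Icc p q) t := by
  have hsub : Metric.closedBall x₀ ((1 : NNReal) : ℝ) ⊆ Metric.closedBall 0 (R + 1) :=
    Metric.closedBall_subset_closedBall' (by simpa [add_comm] using hx₀)
  have h : IsPicardLindelof (fun _ => g) (⟨p, left_mem_Icc.mpr hpq⟩ : Icc p q) x₀ 1 0 ⟨M, hM⟩ L :=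
    .of_time_independent (fun z hz => (hg z (by simpa using hsub hz)).le) (hlip.mono hsub)
      (by simp only [sub_self, max_eq_left (sub_nonneg.mpr hpq)]; simpa using! hMpq)
  exact h.exists_eq_forall_mem_Icc_hasDerivWithinAt₀

end Step

/-! ### Sampled feedback with a semiconcave decrease function -/

section Sampled

variable {E U : Type*} [NormedAddCommGroup E] [InnerProductSpace ℝ E] {f : E → U → E} {k : E → U}
  {φ : E → ℝ} {ζ : E → E} {R M Z C A a c δ κ : ℝ} {L : NNReal}

/-- The feedback `k` makes the function `φ` decrease at rate `c` on `{a ≤ φ} ∩ B_R`, in the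
direction of a supergradient `ζ` of `φ`. Here `C` is a semiconcavity constant of `φ`, `Z` bounds `ζ`
on `B_R`, and `L`, `M` are a Lipschitz constant and a bound on `B_{R+1}` for the vector fields
`f(·, k(z))`. The sublevel set `{φ ≤ A + a}` lies in `B_R`. -/
structure IsDecreasing (f : E → U → E) (k : E → U) (φ : E → ℝ) (ζ : E → E)
    (R M Z C A a c : ℝ) (L : NNReal) : Prop where
  lipschitz : ∀ z, LipschitzOnWith L (fun x => f x (k z)) (Metric.closedBall 0 (R + 1))
  norm_lt : ∀ z x, ‖x‖ ≤ R + 1 → ‖f x (k z)‖ < M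
  le_add : ∀ x z, φ z ≤ φ x + inner ℝ (ζ x) (z - x) + C * ‖z - x‖ ^ 2
  norm_le : ∀ x, ‖x‖ ≤ R → ‖ζ x‖ ≤ Z
  sublevel : ∀ x, φ x ≤ A + a → ‖x‖ ≤ R
  inner_le : ∀ x, ‖x‖ ≤ R → a ≤ φ x → inner ℝ (ζ x) (f x (k x)) ≤ -c

/-- The sampling period `δ` and the relative measurement accuracy `κ` are small relative to the
constants of `IsDecreasing`. -/
structure IsSmallStep (M Z C a c δ κ : ℝ) (L : NNReal) : Prop where
  pos : 0 < δ
  le_one : δ ≤ 1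
  mul_bound : δ * M ≤ 1
  mul_growth : δ * (Z * (M + 1) + C * (M + 1) ^ 2) ≤ a
  mul_rate : δ * (C + Z * L * (M + 1) + C * (M + 1) ^ 2) ≤ c / 4
  gain_pos : 0 < κ
  gain_le_one : κ ≤ 1
  gain_mul : 2 * Z * κ ≤ c / 4

lemma eventually_mul_le (b : ℝ) {ε : ℝ} (hε : 0 < ε) : ∀ᶠ δ in 𝓝[>] (0 : ℝ), δ * b ≤ ε := by
  have hlim : Tendsto (fun δ : ℝ => δ * b) (𝓝[>] 0) (𝓝 0) :=
    ((continuous_id.mul continuous_const).tendsto' 0 0 (by simp)).mono_left nhdsWithin_le_nhds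
  exact hlim.eventually_le_const hε

lemma exists_isSmallStep (M Z C : ℝ) (L : NNReal) {a c ε : ℝ} (ha : 0 < a) (hc : 0 < c)
    (hε : 0 < ε) : ∃ δ κ, δ ≤ ε ∧ IsSmallStep M Z C a c δ κ L := by
  obtain ⟨κ, h1, h2, h3⟩ := ((eventually_mem_nhdsWithin (a := (0 : ℝ)) (s := Ioi 0)).and
    ((eventually_mul_le 1 one_pos).and
      (eventually_mul_le (2 * Z) (by positivity : 0 < c / 4)))).exists
  obtain ⟨δ, h4, h5, h6, h7, h8, h9⟩ := ((eventually_mem_nhdsWithin (a := (0 : ℝ)) (s := Ioi 0)).and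
    ((eventually_mul_le 1 one_pos).and ((eventually_mul_le M one_pos).and
    ((eventually_mul_le (Z * (M + 1) + C * (M + 1) ^ 2) ha).and
    ((eventually_mul_le (C + Z * L * (M + 1) + C * (M + 1) ^ 2) (by positivity : 0 < c / 4)).and
      (eventually_mul_le 1 hε)))))).exists
  exact ⟨δ, κ, by linarith, h4, by linarith, h6, h7, h8, h1, by linarith, by linarith⟩

variable {x : ℝ → E} {v : E} {p q : ℝ}

lemma IsDecreasing.bound_nonneg (h : IsDecreasing f k φ ζ R M Z C A a c L) (hR : 0 ≤ R) :
    0 ≤ M :=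
  (norm_nonneg _).trans (h.norm_lt 0 0 (by simp; linarith)).le

/-- On a sampling interval `φ` grows by at most `a`. -/
lemma IsDecreasing.le_add_of_step (h : IsDecreasing f k φ ζ R M Z C A a c L)
    (hs : IsSmallStep M Z C a c δ κ L) (hR : 0 ≤ R) (hZ : 0 ≤ Z) (hC : 0 ≤ C) (hδ : q - p ≤ δ)
    (hx : ∀ t ∈ Icc p q, HasDerivWithinAt x (f (x t) (k (x p + v))) (Icc p q) t)
    (hp : ‖x p‖ ≤ R) {t : ℝ} (ht : t ∈ Icc p q) : φ (x t) ≤ φ (x p) + a := by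
  have hM := h.bound_nonneg hR
  have hMpq : M * (q - p) ≤ 1 := by nlinarith [hs.mul_bound]
  have hd : ‖x t - x p‖ ≤ δ * (M + 1) := by
    have := norm_sub_le_of_hasDerivWithinAt (g := fun z => f z (k (x p + v))) hx hp
      (h.norm_lt _) hM hMpq t ht
    nlinarith [hs.pos, ht.2]
  have hi : inner ℝ (ζ (x p)) (x t - x p) ≤ Z * (δ * (M + 1)) :=
    (real_inner_le_norm _ _).trans (mul_le_mul (h.norm_le _ hp) hd (norm_nonneg _) hZ)
  have hq : C * ‖x t - x p‖ ^ 2 ≤ C * (δ * (M + 1)) ^ 2 := by gcongr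
  have hδ2 : C * (δ * (M + 1)) ^ 2 ≤ δ * (C * (M + 1) ^ 2) := by
    have : δ * δ * (C * (M + 1) ^ 2) ≤ δ * 1 * (C * (M + 1) ^ 2) := by
      gcongr
      · exact hs.pos.le
      · exact hs.le_one
    linarith
  linarith [h.le_add (x p) (x t), hs.mul_growth]

/-- As long as `φ ≥ 2a` at the sampling time, `φ` decreases over the sampling interval at the
average rate `c / 2`. The supergradient inequality is used at the measured point `x p + v`, where
the feedback is evaluated; since `|v| ≤ κ (q - p)`, passing between the measured and the true state
costs at most a fraction of the gain. -/
lemma IsDecreasing.le_sub_of_step (h : IsDecreasing f k φ ζ R M Z C A a c L)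
    (hs : IsSmallStep M Z C a c δ κ L) (hR : 0 ≤ R) (hZ : 0 ≤ Z) (hC : 0 ≤ C) (hpq : p ≤ q)
    (hδ : q - p ≤ δ) (hv : ‖v‖ ≤ κ * (q - p))
    (hx : ∀ t ∈ Icc p q, HasDerivWithinAt x (f (x t) (k (x p + v))) (Icc p q) t)
    (hpA : φ (x p) ≤ A) (ha : 0 ≤ a) (hpa : 2 * a ≤ φ (x p)) :
    φ (x q) ≤ φ (x p) - c / 2 * (q - p) := by
  set τ := q - p with hτ
  have hτ0 : 0 ≤ τ := sub_nonneg.mpr hpq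
  have hM := h.bound_nonneg hR
  have hp : ‖x p‖ ≤ R := h.sublevel _ (by linarith)
  have hMpq : M * τ ≤ 1 := by nlinarith [hs.mul_bound]
  have hvτ : ‖v‖ ≤ τ := hv.trans (mul_le_of_le_one_left hτ0 hs.gain_le_one)
  have hv2 : C * ‖v‖ ^ 2 ≤ τ * (δ * C) := by
    have : ‖v‖ ^ 2 ≤ τ * δ := by
      rw [sq]; exact mul_le_mul hvτ (hvτ.trans hδ) (norm_nonneg _) hτ0
    nlinarith
  have hZv : Z * ‖v‖ ≤ Z * κ * τ := by nlinarith
  -- The measured point has almost the same value of `φ`, so it lies where `φ` decreases.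
  set y := x p + v with hy
  have herr : Z * ‖v‖ + C * ‖v‖ ^ 2 ≤ a := by
    have h1 : Z * ‖v‖ ≤ δ * (Z * (M + 1)) := by
      have : Z * ‖v‖ ≤ Z * (δ * (M + 1)) := by
        gcongr
        nlinarith [hs.pos]
      linarith
    have h2 : τ * (δ * C) ≤ δ * (C * (M + 1) ^ 2) := by
      have e1 : τ * (δ * C) ≤ 1 * (δ * C) :=
        mul_le_mul_of_nonneg_right (hδ.trans hs.le_one) (mul_nonneg hs.pos.le hC)
      have e2 : δ * C * 1 ≤ δ * C * (M + 1) ^ 2 :=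
        mul_le_mul_of_nonneg_left (by nlinarith) (mul_nonneg hs.pos.le hC)
      linarith
    linarith [hs.mul_growth]
  have hyA : φ y ≤ A + a := by
    have h1 := h.le_add (x p) y
    have h2 : inner ℝ (ζ (x p)) (y - x p) ≤ Z * ‖v‖ := by
      rw [hy, add_sub_cancel_left]
      exact (real_inner_le_norm _ _).trans (by gcongr; exact h.norm_le _ hp)
    rw [show y - x p = v by rw [hy, add_sub_cancel_left]] at h1 h2
    linarith
  have hyR : ‖y‖ ≤ R := h.sublevel y hyA
  have hpy : φ (x p) ≤ φ y + Z * ‖v‖ + C * ‖v‖ ^ 2 := by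
    have h1 := h.le_add y (x p)
    have h2 : inner ℝ (ζ y) (x p - y) ≤ Z * ‖v‖ := by
      refine (real_inner_le_norm _ _).trans ?_
      rw [hy, sub_add_cancel_left, norm_neg]
      gcongr
      exact h.norm_le _ hyR
    rw [show x p - y = -v by rw [hy, sub_add_cancel_left]] at h1 h2
    rw [norm_neg] at h1
    linarith
  have hgain : inner ℝ (ζ y) (f y (k y)) ≤ -c := h.inner_le y hyR (by linarith)
  -- Over the interval the velocity stays close to `f(y, k(y))`.
  have hmove := norm_sub_le_of_hasDerivWithinAt (g := fun z => f z (k y)) hx hp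
    (h.norm_lt _) hM hMpq
  have hnear : ∀ t ∈ Icc p q, ‖x t - y‖ ≤ (M + 1) * τ := fun t ht => by
    have h1 : ‖x t - y‖ ≤ ‖x t - x p‖ + ‖v‖ := by
      rw [hy, ← sub_sub]; exact norm_sub_le _ _
    have h2 : M * (t - p) ≤ M * τ := by rw [hτ]; gcongr; exact ht.2
    linarith [hmove t ht]
  have hvel : ∀ t ∈ Icc p q, ‖f (x t) (k y) - f y (k y)‖ ≤ L * ((M + 1) * τ) := fun t ht => by
    have hxt : ‖x t‖ ≤ R + 1 := by
      have h1 := norm_sub_norm_le (x t) (x p)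
      have h2 : M * (t - p) ≤ M * τ := by rw [hτ]; gcongr; exact ht.2
      linarith [hmove t ht]
    have h1 := (h.lipschitz y).dist_le_mul (x t) (by simpa using hxt) y (by simp; linarith)
    rw [dist_eq_norm, dist_eq_norm] at h1
    exact h1.trans (by gcongr; exact hnear t ht)
  have hint : ‖x q - x p - τ • f y (k y)‖ ≤ L * ((M + 1) * τ) * τ := by
    have h1 := norm_image_sub_le_of_norm_deriv_le_segment'
      (f := fun t => x t - t • f y (k y)) (f' := fun t => f (x t) (k y) - f y (k y))
      (fun t ht => by
        simpa using! (hx t ht).sub ((hasDerivWithinAt_id t (Icc p q)).smul_const (f y (k y))))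
      (fun t ht => hvel t (Ico_subset_Icc_self ht)) q (right_mem_Icc.mpr hpq)
    rw [show x q - x p - τ • f y (k y) = x q - q • f y (k y) - (x p - p • f y (k y)) by
      rw [hτ, sub_smul]; abel]
    exact h1
  have hinner : inner ℝ (ζ y) (x q - y) ≤ -c * τ + Z * (L * ((M + 1) * τ) * τ) + Z * ‖v‖ := by
    have hsplit : x q - y = (x q - x p - τ • f y (k y)) + τ • f y (k y) + -v := by
      rw [hy]; abel
    rw [hsplit, inner_add_right, inner_add_right, real_inner_smul_right, inner_neg_right]
    have h1 : inner ℝ (ζ y) (x q - x p - τ • f y (k y)) ≤ Z * (L * ((M + 1) * τ) * τ) :=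
      (real_inner_le_norm _ _).trans (mul_le_mul (h.norm_le _ hyR) hint (norm_nonneg _) hZ)
    have h2 : τ * inner ℝ (ζ y) (f y (k y)) ≤ τ * -c := by gcongr
    have h3 : -inner ℝ (ζ y) v ≤ Z * ‖v‖ := by
      have := (abs_le.mp (abs_real_inner_le_norm (ζ y) v)).1
      have h4 : ‖ζ y‖ * ‖v‖ ≤ Z * ‖v‖ := by gcongr; exact h.norm_le _ hyR
      linarith
    linarith
  have hquad : C * ‖x q - y‖ ^ 2 ≤ τ * (δ * (C * (M + 1) ^ 2)) := by
    have h1 : C * ‖x q - y‖ ^ 2 ≤ C * ((M + 1) * τ) ^ 2 := by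
      gcongr; exact hnear q (right_mem_Icc.mpr hpq)
    have h2 : τ * τ * (C * (M + 1) ^ 2) ≤ τ * δ * (C * (M + 1) ^ 2) := by gcongr
    linarith
  have hyp : φ y ≤ φ (x p) + Z * ‖v‖ + C * ‖v‖ ^ 2 := by
    have h1 := h.le_add (x p) y
    have h2 : inner ℝ (ζ (x p)) v ≤ Z * ‖v‖ :=
      (real_inner_le_norm _ _).trans (by gcongr; exact h.norm_le _ hp)
    rw [show y - x p = v by rw [hy, add_sub_cancel_left]] at h1
    linarith
  have hlin : Z * (L * ((M + 1) * τ) * τ) ≤ τ * (δ * (Z * L * (M + 1))) := by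
    have : τ * τ * (Z * L * (M + 1)) ≤ τ * δ * (Z * L * (M + 1)) := by gcongr
    linarith
  have hrate := mul_le_mul_of_nonneg_left hs.mul_rate hτ0
  have hκ := mul_le_mul_of_nonneg_right hs.gain_mul hτ0
  linarith [h.le_add y (x q)]

lemma IsDecreasing.le_max_of_step (h : IsDecreasing f k φ ζ R M Z C A a c L)
    (hs : IsSmallStep M Z C a c δ κ L) (hR : 0 ≤ R) (hZ : 0 ≤ Z) (hC : 0 ≤ C) (hpq : p ≤ q)
    (hδ : q - p ≤ δ) (hv : ‖v‖ ≤ κ * (q - p))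
    (hx : ∀ t ∈ Icc p q, HasDerivWithinAt x (f (x t) (k (x p + v))) (Icc p q) t)
    (hpA : φ (x p) ≤ A) (ha : 0 ≤ a) :
    φ (x q) ≤ max (3 * a) (φ (x p) - c / 2 * (q - p)) := by
  rcases le_total (2 * a) (φ (x p)) with h2a | h2a
  · exact le_max_of_le_right (h.le_sub_of_step hs hR hZ hC hpq hδ hv hx hpA ha h2a)
  · refine le_max_of_le_left ?_
    linarith [h.le_add_of_step hs hR hZ hC hδ hx (h.sublevel _ (by linarith))
      (right_mem_Icc.mpr hpq)]

variable {π : SamplingSchedule} {e : ℝ → E}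

/-- The estimate `φ(x(tᵢ)) ≤ max (3a) (A - c tᵢ / 2)` propagates along the sampling times. -/
lemma IsDecreasing.le_of_isSampledSolution (h : IsDecreasing f k φ ζ R M Z C A a c L)
    (hs : IsSmallStep M Z C a c δ κ L) (hR : 0 ≤ R) (hZ : 0 ≤ Z) (hC : 0 ≤ C) (ha : 0 ≤ a)
    (hc : 0 ≤ c) (haA : 3 * a ≤ A) (hπ : ∀ i, π.time (i + 1) - π.time i ≤ δ)
    (he : ∀ t, 0 ≤ t → ‖e t‖ ≤ κ * π.lowerDiam) (hx : IsSampledSolution f k e π x)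
    (hx0 : φ (x 0) ≤ A) (i : ℕ) : φ (x (π.time i)) ≤ max (3 * a) (A - c / 2 * π.time i) := by
  induction i with
  | zero => rw [π.time_zero]; exact le_max_of_le_right (by linarith)
  | succ i ih =>
    have hA : φ (x (π.time i)) ≤ A :=
      ih.trans (max_le haA (by nlinarith [π.time_nonneg i]))
    have hv : ‖e (π.time i)‖ ≤ κ * (π.time (i + 1) - π.time i) :=
      (he _ (π.time_nonneg i)).trans (mul_le_mul_of_nonneg_left (π.lowerDiam_le i) hs.gain_pos.le)
    have hle := π.time_strictMono.monotone i.le_succ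
    refine (h.le_max_of_step hs hR hZ hC hle (hπ i) hv (hx i) hA ha).trans
      (max_le (le_max_left _ _) ?_)
    have hnn : 0 ≤ c / 2 * (π.time (i + 1) - π.time i) :=
      mul_nonneg (by linarith) (sub_nonneg.mpr hle)
    rcases le_max_iff.mp ih with h1 | h1
    · exact le_max_of_le_left (by linarith)
    · exact le_max_of_le_right (by linarith)

lemma IsDecreasing.forall_norm_le (h : IsDecreasing f k φ ζ R M Z C A a c L)
    (hs : IsSmallStep M Z C a c δ κ L) (hR : 0 ≤ R) (hZ : 0 ≤ Z) (hC : 0 ≤ C) (ha : 0 ≤ a)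
    (hc : 0 < c) (haA : 3 * a ≤ A) (hπ : ∀ i, π.time (i + 1) - π.time i ≤ δ)
    (he : ∀ t, 0 ≤ t → ‖e t‖ ≤ κ * π.lowerDiam) (hx : IsSampledSolution f k e π x)
    (hx0 : φ (x 0) ≤ A) :
    (∀ t, 0 ≤ t → ‖x t‖ ≤ R) ∧ ∀ t, 2 * A / c + 1 ≤ t → φ (x t) ≤ 4 * a := by
  have hkey := h.le_of_isSampledSolution hs hR hZ hC ha hc.le haA hπ he hx hx0
  have hstep : ∀ t, 0 ≤ t → ∃ i, t ≤ π.time i + 1 ∧ 0 ≤ π.time i ∧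
      φ (x t) ≤ max (3 * a) (A - c / 2 * π.time i) + a := fun t ht => by
    obtain ⟨i, hi⟩ := π.exists_mem_Ico ht
    have hA : φ (x (π.time i)) ≤ A :=
      (hkey i).trans (max_le haA (by nlinarith [π.time_nonneg i]))
    refine ⟨i, by linarith [hi.2, hπ i, hs.le_one], π.time_nonneg i, ?_⟩
    linarith [hkey i, h.le_add_of_step hs hR hZ hC (hπ i) (hx i) (h.sublevel _ (by linarith))
      (Ico_subset_Icc_self hi)]
  refine ⟨fun t ht => ?_, fun t ht => ?_⟩
  · obtain ⟨i, -, hi, hφ⟩ := hstep t ht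
    refine h.sublevel _ (hφ.trans ?_)
    gcongr
    exact max_le haA (by nlinarith)
  · have hA : 0 ≤ 2 * A / c := div_nonneg (by linarith) hc.le
    obtain ⟨i, hti, -, hφ⟩ := hstep t (by linarith)
    have : A - c / 2 * π.time i ≤ 0 := by
      have h1 : 2 * A / c ≤ π.time i := by linarith
      rw [div_le_iff₀ hc] at h1
      linarith
    rw [max_eq_left (by linarith)] at hφ
    linarith

lemma IsDecreasing.exists_isSampledSolution [CompleteSpace E]
    (h : IsDecreasing f k φ ζ R M Z C A a c L)
    (hs : IsSmallStep M Z C a c δ κ L) (hR : 0 ≤ R) (hZ : 0 ≤ Z) (hC : 0 ≤ C) (ha : 0 ≤ a)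
    (hc : 0 ≤ c) (haA : 3 * a ≤ A) (hπ : ∀ i, π.time (i + 1) - π.time i ≤ δ)
    (he : ∀ t, 0 ≤ t → ‖e t‖ ≤ κ * π.lowerDiam) {x₀ : E} (hx₀ : φ x₀ ≤ A) :
    ∃ x : ℝ → E, IsSampledSolution f k e π x ∧ x 0 = x₀ := by
  refine SampledFeedback.exists_isSampledSolution (P := fun x => φ x ≤ A)
    (fun i z (hz : φ z ≤ A) => ?_) hx₀
  have hle := π.time_strictMono.monotone i.le_succ
  have hM := h.bound_nonneg hR
  obtain ⟨s, rfl, hs'⟩ := exists_solution_Icc (M := M) (R := R) hle (h.sublevel z (by linarith))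
    (h.lipschitz (z + e (π.time i))) (h.norm_lt _) hM (by nlinarith [hs.mul_bound, hπ i])
  have hv : ‖e (π.time i)‖ ≤ κ * (π.time (i + 1) - π.time i) :=
    (he _ (π.time_nonneg i)).trans (mul_le_mul_of_nonneg_left (π.lowerDiam_le i) hs.gain_pos.le)
  refine ⟨s, rfl, (h.le_max_of_step hs hR hZ hC hle (hπ i) hv hs' hz ha).trans (max_le haA ?_), hs'⟩
  nlinarith

end Sampled

/-! ### Stabilization by the inf-convolution feedback -/

section Assembly

variable {E U : Type*} [NormedAddCommGroup E] [InnerProductSpace ℝ E] [ProperSpace E]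
  [NormedAddCommGroup U] {f : E → U → E} {V : E → ℝ} {U₀ : Set U} {α : ℝ}

lemma exists_isInfConvFeedback (hf : Continuous (Function.uncurry f)) (hVc : Continuous V)
    (hp : Tendsto V (cocompact E) atTop) (hU₀ : IsCompact U₀) (hne : U₀.Nonempty) :
    ∃ k, IsInfConvFeedback f V U₀ α k := by
  choose y hy using exists_isMinOn_penalized hVc hp α
  have hcont : ∀ x, Continuous fun u => inner ℝ ((1 / α ^ 2) • (x - y x)) (f x u) := fun x =>
    continuous_const.inner (hf.comp (continuous_const.prodMk continuous_id))
  choose k hkU hk using fun x => hU₀.exists_isMinOn hne (hcont x).continuousOn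
  exact ⟨k, y, hy, fun x => ⟨hkU x, hk x⟩⟩

end Assembly

end SampledFeedback

theorem mainTheorem2 {n m : ℕ}
    (f : EuclideanSpace ℝ (Fin n) → EuclideanSpace ℝ (Fin m) → EuclideanSpace ℝ (Fin n))
    (hf : SampledFeedback.IsRegularDynamics f)
    (V W : EuclideanSpace ℝ (Fin n) → ℝ) (σ : ℝ → ℝ)
    (hV : SampledFeedback.IsCLF f V W σ)
    (r R : ℝ) (hr : 0 < r) (hrR : r < R)
    (hγ : 2 * SampledFeedback.gam V r < SampledFeedback.gam V R)
    (U₀ : Set (EuclideanSpace ℝ (Fin m))) (hU₀ : IsCompact U₀)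
    (hU₀dec : ∀ x, ‖x‖ ≤ R + Real.sqrt (2 * SampledFeedback.bet V R) →
      ∀ ζ ∈ SampledFeedback.proximalSubdiff V x,
        ∃ u ∈ U₀, inner ℝ ζ (f x u) ≤ -W x) :
    ∃ α δ κ T : ℝ, 0 < α ∧ 0 < δ ∧ 0 < κ ∧ 0 < T ∧
      (∃ k, SampledFeedback.IsInfConvFeedback f V U₀ α k) ∧
      ∀ k, SampledFeedback.IsInfConvFeedback f V U₀ α k →
      ∀ π : SampledFeedback.SamplingSchedule,
        (∀ i, π.time (i + 1) - π.time i ≤ δ) →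
        Metric.closedBall 0 (SampledFeedback.rad V R / 2) ⊆
          SampledFeedback.initialSet V α R (κ * π.lowerDiam) ∧
        ∀ e : ℝ → EuclideanSpace ℝ (Fin n), (∀ t, 0 ≤ t → ‖e t‖ ≤ κ * π.lowerDiam) →
        ∀ x₀ ∈ SampledFeedback.initialSet V α R (κ * π.lowerDiam),
          (∃ x : ℝ → EuclideanSpace ℝ (Fin n),
            SampledFeedback.IsSampledSolution f k e π x ∧ x 0 = x₀) ∧
          ∀ x : ℝ → EuclideanSpace ℝ (Fin n),
            SampledFeedback.IsSampledSolution f k e π x → x 0 = x₀ →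
              (∀ t, 0 ≤ t → ‖x t‖ ≤ R) ∧ (∀ t, T ≤ t → ‖x t‖ ≤ r) := by
  open SampledFeedback in
  have hR : 0 < R := hr.trans hrR
  -- In dimension zero both values of `γ` are infima over the empty set, that is `0`.
  have : Nontrivial (EuclideanSpace ℝ (Fin n)) := by
    by_contra hn
    rw [not_nontrivial_iff_subsingleton] at hn
    have hzero : ∀ s, 0 < s → gam V s = 0 := fun s hs => by
      have : {x : EuclideanSpace ℝ (Fin n) | s ≤ ‖x‖} = ∅ := by
        ext x; simp [Subsingleton.elim x 0, hs]
      rw [gam, this, image_empty, Real.sInf_empty]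
    rw [hzero r hr, hzero R hR] at hγ
    simp at hγ
  have hpd := hV.posDef
  have hgr : 0 < gam V r := gam_pos hpd hV.continuous hV.proper hr
  have hgR : 0 < gam V R := gam_pos hpd hV.continuous hV.proper hR
  have hρ : 0 < rad V R := rad_pos hpd hV.continuous hR hgR
  -- Zero is a proximal subgradient at the minimum point `0`, so there is at least one control.
  have hne : U₀.Nonempty := by
    obtain ⟨u, hu, -⟩ := hU₀dec 0 (by rw [norm_zero]; positivity) 0
      ⟨1, one_pos, Eventually.of_forall fun y => by
        rw [hpd.1, inner_zero_left]; nlinarith [hpd.nonneg y, sq_nonneg ‖y - 0‖]⟩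
    exact ⟨u, hu⟩
  obtain ⟨L, hL⟩ := hf.exists_lipschitzOnWith hU₀
    (isCompact_closedBall (0 : EuclideanSpace ℝ (Fin n)) (R + 1))
  obtain ⟨M, -, hM⟩ := hf.exists_norm_lt hU₀
    (isCompact_closedBall (0 : EuclideanSpace ℝ (Fin n)) (R + 1))
  have ha : 0 < gam V r / 8 := by positivity
  obtain ⟨c, hc, hdec⟩ := eventually_inner_le_neg hf hpd hV.continuous hV.posDef_rate
    hV.continuous_rate hU₀ hU₀dec ha
  obtain ⟨α, hα, hdec, hsubR, hsubr⟩ :=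
    ((eventually_mem_nhdsWithin (a := (0 : ℝ)) (s := Ioi 0)).and (hdec.and
      ((eventually_norm_le_of_infConv_le hpd hV.continuous hV.proper hgR).and
        (eventually_norm_le_of_infConv_le hpd hV.continuous hV.proper hgr)))).exists
  have hα : 0 < α := hα
  have hZ : 0 ≤ Real.sqrt (2 * bet V R) / α := by positivity
  have hC : 0 ≤ 1 / (2 * α ^ 2) := by positivity
  obtain ⟨δ, κ, hδρ, hs⟩ := exists_isSmallStep M (Real.sqrt (2 * bet V R) / α)
    (1 / (2 * α ^ 2)) L ha hc (show 0 < rad V R / 4 by positivity)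
  refine ⟨α, δ, κ, 2 * (gam V R / 2) / c + 1, hα, hs.pos, hs.gain_pos, by positivity,
    exists_isInfConvFeedback hf.1 hV.continuous hV.proper hU₀ hne, ?_⟩
  rintro k ⟨y, hy, hk⟩ π hπ
  have hπ0 := π.lowerDiam_nonneg
  have hε : κ * π.lowerDiam ≤ rad V R / 4 := by
    have := (π.lowerDiam_le 0).trans (hπ 0)
    nlinarith [hs.gain_le_one]
  refine ⟨closedBall_subset_initialSet hpd hgR.le hρ hε, fun e he x₀ hx₀ => ?_⟩
  have h : IsDecreasing f k (infConv V α) (fun x => (1 / α ^ 2) • (x - y x)) R M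
      (Real.sqrt (2 * bet V R) / α) (1 / (2 * α ^ 2)) (gam V R / 2) (gam V r / 8) c L :=
    { lipschitz := fun z => hL _ (hk z).1
      norm_lt := fun z x hx => hM _ (hk z).1 x (by simpa using hx)
      le_add := fun x z => infConv_le_add_inner hpd hα (hy x) z
      norm_le := fun x hx => norm_smul_sub_le_of_isMinOn hpd hα (hy x)
        ((infConv_le hpd α x).trans (le_bet hV.continuous hx))
      sublevel := fun x hx => hsubR x (by linarith)
      inner_le := fun x hx hax => hdec x (y x) (k x) hx hax (hy x) (hk x).2 }
  have hφ₀ : infConv V α x₀ ≤ gam V R / 2 :=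
    hx₀ x₀ (by simpa using mul_nonneg hs.gain_pos.le hπ0)
  refine ⟨h.exists_isSampledSolution hs hR.le hZ hC ha.le hc.le (by linarith) hπ he hφ₀,
    fun x hx hx0 => ?_⟩
  obtain ⟨hball, hlate⟩ := h.forall_norm_le hs hR.le hZ hC ha.le hc (by linarith) hπ he hx
    (by rw [hx0]; exact hφ₀)
  exact ⟨hball, fun t ht => hsubr _ (by linarith [hlate t ht])⟩
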